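/- Let $G=(V,E)$ be a finite, connected, undirected simple graph and let $A:V\times\mathbb N\to\{\mathrm{true},\mathrm{false}\}$ be an availability scheme, i.e. a function for which $f=|\{(v,i): A(v,i)=\mathrm{false}\}|$ is finite. A node $v_0\in V$ broadcasts a message $m$ by the following synchronous algorithm $\mathcal A_{FI}$, with rounds $1,2,3,\dots$. Every node $v$ has a Boolean flag $\mathit{parity}$, with an arbitrary initial value (not necessarily the same for all nodes), and two variables $M(\mathrm{true})$, $M(\mathrm{false})$, initially both $\bot$. Before round $1$, node $v_0$ sets its $M(\mathit{parity}):=\emptyset$. In each round $i\ge 1$, every node $v$ first adds to its $M(\mathit{parity})$ all neighbors that sent $m$ to $v$ in round $i-1$ (where adding $w$ to $\bot$ gives $\{w\}$; in round $1$ nothing is received). Then, if $A(v,i)=\mathrm{true}$ and $M(\mathit{parity})\neq\bot$, node $v$ sends $m$ to all nodes in $N(v)\setminus M(\mathit{parity})$, where $N(v)$ is the set of neighbors of $v$ in $G$, and sets $M(\mathit{parity}):=\bot$. At the end of the round $v$ negates $\mathit{parity}$. Then: 1. The message is delivered after at most $\mathrm{Diam}(G)+2f$ rounds: for every node $w\ne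 v_0$, some node sends $m$ to $w$ in one of the rounds $1,\dots,\mathrm{Diam}(G)+2f$. 2. The broadcast terminates after at most $2\,\mathrm{Diam}(G)+2f+1$ rounds: no node sends $m$ in any later round. 3. The total number of times that $m$ is sent over an edge (the number of triples $(i,v,w)$ such that $v$ sends $m$ to $w$ in round $i$) is $|E|$ if $G$ is bipartite, and $2|E|$ otherwise. -/

import Mathlib

/-!
Synchronous execution of amnesiac flooding with intermittent channels for a single message `m`
that is broadcast by one node `v₀` of a graph `G`. Rounds are numbered `1, 2, 3, …`. A message
sent in round `i` travels during round `i` and is processed by its receiver at the beginning of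
round `i + 1`.
-/

namespace AmnesiacFlooding

variable {V : Type*}

/-- The pairs `(v, i)` for which the channel of node `v` is blocked in round `i`. -/
def blockedPairs (A : V → ℕ → Bool) : Set (V × ℕ) :=
  {p | A p.1 p.2 = false}

/-- `A` is an availability scheme: only finitely many pairs `(v, i)` are blocked. -/
def IsAvailabilityScheme (A : V → ℕ → Bool) : Prop :=
  (blockedPairs A).Finite

/-- The local variables of a node: the flag `parity` and, for each of its two values, a set
`M parity` of senders; `none` is the symbol `⊥`, which is different from the empty set. -/
structure NodeState (V : Type*) where
  parity : Bool
  M : Bool → Option (Set V)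

/-- Initial values of the local variables. -/
def NodeState.initial (parity₀ : Bool) : NodeState V :=
  ⟨parity₀, fun _ => none⟩

/-- The function `broadcast(m)`: `M(parity) := ∅`. -/
def NodeState.broadcast (s : NodeState V) : NodeState V :=
  ⟨s.parity, Function.update s.M s.parity (some ∅)⟩

open Classical in
/-- Adding all members of `R` to a value of `M`: adding `w` to `⊥` results in `{w}`. If `R` is
empty, then nothing is added. -/
noncomputable def addSenders (m : Option (Set V)) (R : Set V) : Option (Set V) :=
  if R = ∅ then m else some (m.getD ∅ ∪ R)

/-- Receiving `m` from exactly the nodes in `R`: `M(parity).add(w)` for all `w ∈ R`. -/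
noncomputable def NodeState.receive (s : NodeState V) (R : Set V) : NodeState V :=
  ⟨s.parity, Function.update s.M s.parity (addSenders (s.M s.parity) R)⟩

/-- The nodes to which a node `v` in state `s` sends `m`: these are the nodes of
`N(v) \ M(parity)` if the channel is available and `M(parity) ≠ ⊥`, and none otherwise. -/
def NodeState.targets (G : SimpleGraph V) (v : V) (available : Bool) (s : NodeState V) : Set V :=
  {u | available = true ∧ ∃ S, s.M s.parity = some S ∧ u ∈ G.neighborSet v \ S}

/-- The state after the sending step: if the channel is available, then `M(parity)` is `⊥`. -/
def NodeState.afterSend (available : Bool) (s : NodeState V) : NodeState V :=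
  if available = true then ⟨s.parity, Function.update s.M s.parity none⟩ else s

/-- End of a round: `parity := ¬ parity`. -/
def NodeState.toggle (s : NodeState V) : NodeState V :=
  ⟨!s.parity, s.M⟩

/-- A global configuration after some round: the state of each node, and the messages sent in
that round (`transit v w` means that `v` has sent `m` to `w`). -/
structure Config (V : Type*) where
  node : V → NodeState V
  transit : V → V → Prop

open Classical in
/-- The configuration before round `1`: all nodes are initialized (node `v` with the value
`parity₀ v` of its flag), `v₀` has invoked `broadcast(m)`, and no message is in transit. -/
noncomputable def Config.start (v₀ : V) (parity₀ : V → Bool) : Config V where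
  node v := if v = v₀ then (NodeState.initial (parity₀ v)).broadcast
    else NodeState.initial (parity₀ v)
  transit _ _ := False

/-- The state of node `v` immediately before it checks its channel. -/
noncomputable def Config.received (c : Config V) (v : V) : NodeState V :=
  (c.node v).receive {w | c.transit w v}

/-- One synchronous round, in which the channel of node `v` is available iff `avail v`. -/
noncomputable def Config.step (G : SimpleGraph V) (avail : V → Bool) (c : Config V) :
    Config V where
  node v := ((c.received v).afterSend (avail v)).toggle
  transit v w := w ∈ (c.received v).targets G v (avail v)

/-- The configuration after the given number of rounds. -/
noncomputable def config (G : SimpleGraph V) (A : V → ℕ → Bool) (v₀ : V) (parity₀ : V → Bool) :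
    ℕ → Config V
  | 0 => Config.start v₀ parity₀
  | i + 1 => (config G A v₀ parity₀ i).step G (fun v => A v (i + 1))

/-- Node `v` sends `m` to node `w` in round `i` (never true for `i = 0`). -/
def Sends (G : SimpleGraph V) (A : V → ℕ → Bool) (v₀ : V) (parity₀ : V → Bool)
    (i : ℕ) (v w : V) : Prop :=
  (config G A v₀ parity₀ i).transit v w

/-- The message is delivered after at most `t` rounds: every node other than the originator
has been sent the message in one of the rounds `1, …, t`. -/
def DeliversWithin (G : SimpleGraph V) (A : V → ℕ → Bool) (v₀ : V) (parity₀ : V → Bool)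
    (t : ℕ) : Prop :=
  ∀ w, w ≠ v₀ → ∃ i ≤ t, ∃ v, Sends G A v₀ parity₀ i v w

/-- The broadcast terminates after at most `t` rounds: no message is sent in a later round. -/
def TerminatesWithin (G : SimpleGraph V) (A : V → ℕ → Bool) (v₀ : V) (parity₀ : V → Bool)
    (t : ℕ) : Prop :=
  ∀ i, t < i → ∀ v w, ¬ Sends G A v₀ parity₀ i v w

/-- The set of all forwards `(i, v, w)` of the message: in round `i` from `v` to `w`. -/
def forwards (G : SimpleGraph V) (A : V → ℕ → Bool) (v₀ : V) (parity₀ : V → Bool) :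
    Set (ℕ × V × V) :=
  {e | Sends G A v₀ parity₀ e.1 e.2.1 e.2.2}

end AmnesiacFlooding

/-! The two variables of a node are used in alternate rounds, so the run lives on the bipartite
double cover of `G`, with vertices (node, parity of time); time `i` means round `i + 1`. There it is
ordinary flooding: a vertex fires at most once, and on firing it sends exactly to the neighbors that
have not fired (`sends_succ_iff_fires`, `isFiring_fires`).

Each blocked pair belongs to one vertex of the cover and delays it by at most two rounds. Charging
delays layer by layer, a vertex reached by a walk of length `k` fires by time `k + 2 * f`
(`exists_fires_le_ncard`). This gives delivery directly, and termination because every reachable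
edge of the cover has an end within `2 * diam` (`exists_short_reachesIn`).

Each reachable edge of the cover is crossed exactly once, from its earlier end to its later one
(`exists_forward`, `not_forward_back`). The reachable part is a copy of `G` if `G` is bipartite, and
otherwise the whole cover, which has twice as many edges. -/

namespace AmnesiacFlooding

variable {V : Type*}

/-! ### The content of the active variable -/

section Execution

variable (G : SimpleGraph V) (A : V → ℕ → Bool) (v₀ : V) (parity₀ : V → Bool)

/-- The value of `M parity` of node `v` in round `i + 1` after the received messages have been
processed. -/
noncomputable def activeSenders (i : ℕ) (v : V) : Option (Set V) :=
  ((config G A v₀ parity₀ i).received v).M ((config G A v₀ parity₀ i).received v).parity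

/-- Node `v` empties its active variable in round `i + 1`. -/
def Fires (i : ℕ) (v : V) : Prop :=
  A v (i + 1) = true ∧ activeSenders G A v₀ parity₀ i v ≠ none

end Execution

/-- For a family `F` of events, `F` has happened to `v` before time `i` at a time of the same
parity as `i`. -/
def HasFired (F : ℕ → V → Prop) (i : ℕ) (v : V) : Prop :=
  ∃ j < i, j % 2 = i % 2 ∧ F j v

lemma not_hasFired_zero (F : ℕ → V → Prop) (v : V) : ¬ HasFired F 0 v := by
  rintro ⟨j, hj, -⟩
  omega

lemma not_hasFired_one (F : ℕ → V → Prop) (v : V) : ¬ HasFired F 1 v := by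
  rintro ⟨j, hj, h, -⟩
  omega

lemma hasFired_add_two (F : ℕ → V → Prop) (i : ℕ) (v : V) :
    HasFired F (i + 2) v ↔ HasFired F i v ∨ F i v := by
  constructor
  · rintro ⟨j, hj, h, hF⟩
    rcases Nat.lt_or_ge j i with hji | hji
    · exact .inl ⟨j, hji, by omega, hF⟩
    · obtain rfl : j = i := by omega
      exact .inr hF
  · rintro (⟨j, hj, h, hF⟩ | hF)
    · exact ⟨j, by omega, by omega, hF⟩
    · exact ⟨i, by omega, by omega, hF⟩

lemma HasFired.mono {F : ℕ → V → Prop} {i j : ℕ} {v : V} (h : HasFired F i v) (hij : i ≤ j)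
    (hmod : i % 2 = j % 2) : HasFired F j v := by
  obtain ⟨k, hk, hkm, hF⟩ := h
  exact ⟨k, by omega, by omega, hF⟩

section Execution

variable {G : SimpleGraph V} {A : V → ℕ → Bool} {v₀ : V} {parity₀ : V → Bool}

open Classical in
lemma activeSenders_zero (v : V) :
    activeSenders G A v₀ parity₀ 0 v = if v = v₀ then some ∅ else none := by
  by_cases h : v = v₀ <;>
    simp [activeSenders, config, Config.received, NodeState.receive, Config.start, addSenders,
      NodeState.broadcast, NodeState.initial, h]

lemma activeSenders_one (v : V) :
    activeSenders G A v₀ parity₀ 1 v =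
      addSenders none {w | Sends G A v₀ parity₀ 1 w v} := by
  by_cases h : v = v₀ <;> by_cases ha : A v 1 = true <;>
    simp [activeSenders, config, Config.received, NodeState.receive, Config.start, addSenders,
      NodeState.broadcast, NodeState.initial, h, Config.step, NodeState.toggle,
      NodeState.afterSend, Sends, ha] <;> simp_all

/-- Two toggles restore the flag, and the round in between touches only the other variable. Hence
the recursion has step two, and the initial flags do not matter. -/
lemma activeSenders_add_two (i : ℕ) (v : V) :
    activeSenders G A v₀ parity₀ (i + 2) v =
      addSenders (if A v (i + 1) = true then none else activeSenders G A v₀ parity₀ i v)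
        {w | Sends G A v₀ parity₀ (i + 2) w v} := by
  have key : ∀ (s : NodeState V) (R R' : Set V) (a b : Bool),
      ((((((s.receive R).afterSend a).toggle.receive R').afterSend b).toggle).M
        (((((s.receive R).afterSend a).toggle.receive R').afterSend b).toggle).parity) =
      if a = true then none else (s.receive R).M (s.receive R).parity := by
    intro s R R' a b
    cases a <;> cases b <;>
      simp [NodeState.receive, NodeState.afterSend, NodeState.toggle]
  have hreceive : ∀ (s : NodeState V) (R : Set V),
      (s.receive R).M (s.receive R).parity = addSenders (s.M s.parity) R :=
    fun s R => Function.update_self _ _ _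
  rw [activeSenders, activeSenders, Config.received, hreceive]
  exact congrArg (addSenders · _) (key _ _ _ _ _)

lemma sends_succ_iff (i : ℕ) (v u : V) :
    Sends G A v₀ parity₀ (i + 1) v u ↔
      A v (i + 1) = true ∧ ∃ S, activeSenders G A v₀ parity₀ i v = some S ∧ G.Adj v u ∧ u ∉ S :=
  Iff.rfl

lemma not_sends_zero (v u : V) : ¬ Sends G A v₀ parity₀ 0 v u := id

end Execution

/-- The neighbors of `v` that have fired before time `i` at a time of parity different from `i`. -/
def firedNeighbors (G : SimpleGraph V) (F : ℕ → V → Prop) (i : ℕ) (v : V) : Set V :=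
  {u | G.Adj v u ∧ HasFired F (i + 1) u}

lemma firedNeighbors_add_two (G : SimpleGraph V) (F : ℕ → V → Prop) (i : ℕ) (v : V) :
    firedNeighbors G F (i + 2) v = firedNeighbors G F i v ∪ {w | G.Adj v w ∧ F (i + 1) w} := by
  ext u
  have := hasFired_add_two F (i + 1) u
  simp only [firedNeighbors, Set.mem_ofPred_eq, Set.mem_union]
  rw [show i + 2 + 1 = i + 1 + 2 by omega, this]
  tauto

section Execution

variable (G : SimpleGraph V) (A : V → ℕ → Bool) (v₀ : V) (parity₀ : V → Bool)

open Classical in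
/-- The value predicted for `activeSenders`. -/
noncomputable def predictedSenders (i : ℕ) (v : V) : Option (Set V) :=
  if HasFired (Fires G A v₀ parity₀) i v ∨
      (firedNeighbors G (Fires G A v₀ parity₀) i v = ∅ ∧ ¬ (v = v₀ ∧ i % 2 = 0)) then none
  else some (firedNeighbors G (Fires G A v₀ parity₀) i v)

variable {G A v₀ parity₀}

lemma sends_succ_iff_of_predicted {i : ℕ}
    (h : ∀ v, activeSenders G A v₀ parity₀ i v = predictedSenders G A v₀ parity₀ i v) (v u : V) :
    Sends G A v₀ parity₀ (i + 1) v u ↔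
      Fires G A v₀ parity₀ i v ∧ G.Adj v u ∧ ¬ HasFired (Fires G A v₀ parity₀) (i + 1) u := by
  rw [sends_succ_iff, Fires, h, predictedSenders]
  split_ifs with hc
  · simp
  · simp only [Option.some.injEq, exists_eq_left', firedNeighbors, Set.mem_ofPred_eq, ne_eq,
      reduceCtorEq, not_false_eq_true, and_true]
    tauto

lemma addSenders_empty (m : Option (Set V)) : addSenders m ∅ = m := by simp [addSenders]

/-- The induction carries two consecutive times: the stored value comes from time `i`, the received
messages from firings at time `i + 1`. -/
lemma activeSenders_eq_predicted (i : ℕ) :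
    (∀ v, activeSenders G A v₀ parity₀ i v = predictedSenders G A v₀ parity₀ i v) ∧
    (∀ v, activeSenders G A v₀ parity₀ (i + 1) v =
      predictedSenders G A v₀ parity₀ (i + 1) v) := by
  induction i with
  | zero =>
    have h0 : ∀ v, activeSenders G A v₀ parity₀ 0 v = predictedSenders G A v₀ parity₀ 0 v := by
      intro v
      have hN : firedNeighbors G (Fires G A v₀ parity₀) 0 v = ∅ := by
        simp [firedNeighbors, not_hasFired_one]
      rw [activeSenders_zero, predictedSenders, hN]
      by_cases h : v = v₀ <;> simp [h, not_hasFired_zero]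
    refine ⟨h0, fun v => ?_⟩
    have hS : {w | Sends G A v₀ parity₀ 1 w v} =
        firedNeighbors G (Fires G A v₀ parity₀) 1 v := by
      ext w
      have := sends_succ_iff_of_predicted h0 w v
      simp only [zero_add] at this
      simp only [Set.mem_ofPred_eq, this, firedNeighbors, hasFired_add_two _ 0 w,
        not_hasFired_one, not_hasFired_zero, G.adj_comm w v]
      tauto
    rw [zero_add, activeSenders_one, hS, predictedSenders, addSenders]
    simp [not_hasFired_one]
  | succ i ih =>
    obtain ⟨h0, h1⟩ := ih
    refine ⟨h1, fun v => ?_⟩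
    set F := Fires G A v₀ parity₀ with hF
    have hS : {w | Sends G A v₀ parity₀ (i + 2) w v} =
        {w | G.Adj v w ∧ F (i + 1) w ∧ ¬ HasFired F (i + 2) v} := by
      ext w
      have := sends_succ_iff_of_predicted h1 w v
      simp only [Set.mem_ofPred_eq, this, G.adj_comm w v]
      tauto
    have hFi : F i v ↔ A v (i + 1) = true ∧ predictedSenders G A v₀ parity₀ i v ≠ none := by
      rw [hF, Fires, h0]
    rw [show i + 1 + 1 = i + 2 from rfl, activeSenders_add_two, h0, hS]
    -- A fired vertex is skipped by all later senders, so its variable stays `none`.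
    by_cases hH : HasFired F (i + 2) v
    · have hr : predictedSenders G A v₀ parity₀ (i + 2) v = none := by
        rw [predictedSenders, if_pos (Or.inl hH)]
      rw [hr]
      simp only [hH, not_true_eq_false, and_false, Set.ofPred_false, addSenders_empty]
      rcases (hasFired_add_two F i v).1 hH with h | h
      · rw [predictedSenders, if_pos (Or.inl h), ite_self]
      · rw [if_pos (hFi.1 h).1]
    · have hH' := hH
      rw [hasFired_add_two, not_or] at hH'
      -- An open channel without firing means that the variable was already `none`, so clearing it
      -- changes nothing.
      have hm : (if A v (i + 1) = true then none else predictedSenders G A v₀ parity₀ i v) =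
          predictedSenders G A v₀ parity₀ i v := by
        split_ifs with ha
        · by_contra hne
          exact hH'.2 (hFi.2 ⟨ha, fun h => hne h.symm⟩)
        · rfl
      simp only [hH, not_false_eq_true, and_true]
      rw [hm, predictedSenders, predictedSenders, firedNeighbors_add_two, ← hF]
      rw [Nat.add_mod_right, addSenders]
      generalize firedNeighbors G F i v = N
      generalize {w | G.Adj v w ∧ F (i + 1) w} = R
      generalize HasFired F (i + 2) v = p at hH
      generalize HasFired F i v = q at hH'
      split_ifs <;> simp_all

theorem sends_succ_iff_fires (i : ℕ) (v u : V) :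
    Sends G A v₀ parity₀ (i + 1) v u ↔
      Fires G A v₀ parity₀ i v ∧ G.Adj v u ∧ ¬ HasFired (Fires G A v₀ parity₀) (i + 1) u :=
  sends_succ_iff_of_predicted (activeSenders_eq_predicted i).1 v u

end Execution

/-! ### The recurrence for firing times -/

/-- `F` is the family of firing events: `v` fires as soon as its channel is available, if it has
not fired before at a time of the same parity and either it is the originator (at even times) or
one of its neighbors has fired before at a time of the other parity. -/
def IsFiring (G : SimpleGraph V) (A : V → ℕ → Bool) (v₀ : V) (F : ℕ → V → Prop) : Prop :=
  ∀ i v, F i v ↔ A v (i + 1) = true ∧ ¬ HasFired F i v ∧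
    ((v = v₀ ∧ i % 2 = 0) ∨ ∃ u, G.Adj v u ∧ HasFired F (i + 1) u)

theorem isFiring_fires (G : SimpleGraph V) (A : V → ℕ → Bool) (v₀ : V) (parity₀ : V → Bool) :
    IsFiring G A v₀ (Fires G A v₀ parity₀) := by
  intro i v
  have hne : (∃ u, G.Adj v u ∧ HasFired (Fires G A v₀ parity₀) (i + 1) u) ↔
      firedNeighbors G (Fires G A v₀ parity₀) i v ≠ ∅ := by
    rw [← Set.nonempty_iff_ne_empty]
    rfl
  rw [hne]
  conv_lhs => rw [Fires, (activeSenders_eq_predicted i).1, predictedSenders]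
  split_ifs with h
  · simp only [ne_eq, not_true_eq_false, and_false, false_iff]
    tauto
  · simp only [ne_eq, reduceCtorEq, not_false_eq_true, and_true]
    tauto

/-! ### Walks and the parity of their lengths -/

/-- There is a walk of length `k` from `v₀` to `v`. -/
def ReachesIn (G : SimpleGraph V) (v₀ : V) (k : ℕ) (v : V) : Prop :=
  ∃ p : G.Walk v₀ v, p.length = k

section Walks

variable {G : SimpleGraph V} {v₀ : V}

lemma reachesIn_zero : ReachesIn G v₀ 0 v₀ := ⟨.nil, rfl⟩

lemma ReachesIn.succ {k : ℕ} {u v : V} (h : ReachesIn G v₀ k u) (huv : G.Adj u v) :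
    ReachesIn G v₀ (k + 1) v := by
  obtain ⟨p, rfl⟩ := h
  exact ⟨p.concat huv, p.length_concat huv⟩

lemma ReachesIn.trans {k l : ℕ} {u v : V} (h : ReachesIn G v₀ k u) (h' : ReachesIn G u l v) :
    ReachesIn G v₀ (k + l) v := by
  obtain ⟨p, rfl⟩ := h
  obtain ⟨q, rfl⟩ := h'
  exact ⟨p.append q, p.length_append q⟩

lemma reachesIn_zero_iff {v : V} : ReachesIn G v₀ 0 v ↔ v = v₀ := by
  constructor
  · rintro ⟨p, hp⟩
    exact (SimpleGraph.Walk.eq_of_length_eq_zero hp).symm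
  · rintro rfl
    exact reachesIn_zero

lemma reachesIn_succ_iff {k : ℕ} {v : V} :
    ReachesIn G v₀ (k + 1) v ↔ ∃ u, G.Adj u v ∧ ReachesIn G v₀ k u := by
  constructor
  · rintro ⟨p, hp⟩
    have hn : ¬ p.Nil := by
      rw [SimpleGraph.Walk.not_nil_iff_lt_length]
      omega
    refine ⟨p.penultimate, p.adj_penultimate hn, p.dropLast, ?_⟩
    have := congrArg SimpleGraph.Walk.length (p.concat_dropLast (p.adj_penultimate hn))
    rw [SimpleGraph.Walk.length_concat] at this
    omega
  · rintro ⟨u, huv, hu⟩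
    exact hu.succ huv

lemma reachesIn_dist (hG : G.Connected) (u v : V) : ReachesIn G u (G.dist u v) v :=
  hG.exists_walk_length_eq_dist u v

/-- If no edge has both ends at the same distance from `v₀`, then the parity of the length of a
walk starting in `v₀` is determined by its end. -/
lemma ReachesIn.mod_two_eq_dist (hG : G.Connected)
    (hE : ∀ a b, G.Adj a b → G.dist v₀ a ≠ G.dist v₀ b) {k : ℕ} {v : V}
    (h : ReachesIn G v₀ k v) : k % 2 = G.dist v₀ v % 2 := by
  induction k generalizing v with
  | zero => simp [reachesIn_zero_iff.1 h]
  | succ k ih =>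
    obtain ⟨u, huv, hu⟩ := reachesIn_succ_iff.1 h
    have h1 := ih hu
    have h2 := hE u v huv
    have h3 := hG.dist_triangle (u := v₀) (v := u) (w := v)
    have h4 := hG.dist_triangle (u := v₀) (v := v) (w := u)
    rw [SimpleGraph.dist_eq_one_iff_adj.2 huv] at h3
    rw [SimpleGraph.dist_eq_one_iff_adj.2 huv.symm] at h4
    omega

lemma isBipartite_of_forall_dist_ne (hG : G.Connected)
    (hE : ∀ a b, G.Adj a b → G.dist v₀ a ≠ G.dist v₀ b) : G.IsBipartite := by
  refine ⟨SimpleGraph.Coloring.mk (fun v => (⟨G.dist v₀ v % 2, by omega⟩ : Fin 2)) ?_⟩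
  intro u v huv h
  have h1 := ((reachesIn_dist hG v₀ u).succ huv).mod_two_eq_dist hG hE
  simp only [Fin.mk.injEq] at h
  omega

/-- In a non-bipartite connected graph, every node is reached by walks of both parities. -/
lemma exists_reachesIn_of_not_isBipartite (hG : G.Connected) (hb : ¬ G.IsBipartite) (c : ℕ)
    (v : V) : ∃ k, k % 2 = c % 2 ∧ ReachesIn G v₀ k v := by
  by_contra hcon
  refine hb (isBipartite_of_forall_dist_ne (v₀ := v₀) hG fun a b hab he => hcon ?_)
  have h1 := (reachesIn_dist hG v₀ b).trans (reachesIn_dist hG b v)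
  have h2 := ((reachesIn_dist hG v₀ a).succ hab).trans (reachesIn_dist hG b v)
  by_cases h : (G.dist v₀ b + G.dist b v) % 2 = c % 2
  · exact ⟨_, h, h1⟩
  · exact ⟨_, by omega, h2⟩

lemma dist_le_diam_of_connected [Finite V] (hG : G.Connected) (u v : V) :
    G.dist u v ≤ G.diam := by
  have := hG.nonempty
  exact SimpleGraph.dist_le_diam (SimpleGraph.connected_iff_ediam_ne_top.1 hG)

/-- Of two vertices of the bipartite double cover on opposite sides, the first of which is
reachable from `v₀`, one is reached by a walk of length at most twice the diameter. -/
lemma exists_short_reachesIn [Finite V] (hG : G.Connected) {k : ℕ} {v : V} (u : V)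
    (h : ReachesIn G v₀ k v) :
    (∃ l ≤ 2 * G.diam, l % 2 = k % 2 ∧ ReachesIn G v₀ l v) ∨
    (∃ l ≤ 2 * G.diam, l % 2 = (k + 1) % 2 ∧ ReachesIn G v₀ l u) := by
  have hd := dist_le_diam_of_connected hG
  by_cases hv : G.dist v₀ v % 2 = k % 2
  · exact .inl ⟨_, by have := hd v₀ v; omega, hv, reachesIn_dist hG v₀ v⟩
  by_cases hE : ∀ a b, G.Adj a b → G.dist v₀ a ≠ G.dist v₀ b
  · exact absurd (h.mod_two_eq_dist hG hE).symm hv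
  push Not at hE
  obtain ⟨a, b, hab, he⟩ := hE
  have hb := hd v₀ b
  have hbv := hd b v
  have hbu := hd b u
  have v1 := (reachesIn_dist hG v₀ b).trans (reachesIn_dist hG b v)
  have v2 := ((reachesIn_dist hG v₀ a).succ hab).trans (reachesIn_dist hG b v)
  have u1 := (reachesIn_dist hG v₀ b).trans (reachesIn_dist hG b u)
  have u2 := ((reachesIn_dist hG v₀ a).succ hab).trans (reachesIn_dist hG b u)
  by_cases c1 : (G.dist v₀ b + G.dist b v) % 2 = k % 2
  · exact .inl ⟨_, by omega, c1, v1⟩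
  by_cases c2 : (G.dist v₀ b + G.dist b u) % 2 = (k + 1) % 2
  · exact .inr ⟨_, by omega, c2, u1⟩
  -- Failure of `c1` and `c2` makes the distances from `b` to `v` and to `u` differ in parity. They
  -- cannot both equal the diameter, so `v2` or `u2` is short enough.
  by_cases c3 : G.dist v₀ a + 1 + G.dist b v ≤ 2 * G.diam
  · exact .inl ⟨_, c3, by omega, v2⟩
  · exact .inr ⟨_, by omega, by omega, u2⟩

end Walks

/-! ### Flooding with delays on the double cover -/

namespace IsFiring

variable {G : SimpleGraph V} {A : V → ℕ → Bool} {v₀ : V} {F : ℕ → V → Prop}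

lemma eq_of_fires (hF : IsFiring G A v₀ F) {i j : ℕ} {v : V} (hi : F i v) (hj : F j v)
    (hij : i % 2 = j % 2) : i = j := by
  rcases lt_trichotomy i j with h | h | h
  · exact absurd ⟨i, h, hij, hi⟩ ((hF j v).1 hj).2.1
  · exact h
  · exact absurd ⟨j, h, hij.symm, hj⟩ ((hF i v).1 hi).2.1

/-- The channel of a node that may fire delays it by two rounds for each blocked round. -/
lemma exists_fires_le (hF : IsFiring G A v₀ F) {e : ℕ} {v : V}
    (he : (v = v₀ ∧ e % 2 = 0) ∨ ∃ u, G.Adj v u ∧ HasFired F (e + 1) u)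
    {s : Set (V × ℕ)} (hs : s.Finite)
    (hsub : ∀ i, i % 2 = e % 2 → A v (i + 1) = false → (v, i + 1) ∈ s) :
    ∃ j ≤ e + 2 * s.ncard, j % 2 = e % 2 ∧ F j v := by
  by_contra! hcon
  -- Without a firing, all `s.ncard + 1` candidate times would be blocked, which is one more than
  -- `s` can hold.
  have hblock : ∀ t ≤ s.ncard, (v, e + 2 * t + 1) ∈ s := by
    intro t ht
    refine hsub _ (by omega) ?_
    have hn := hcon (e + 2 * t) (by omega) (by omega)
    rw [hF] at hn
    by_contra hA
    refine hn ⟨by simpa using hA, ?_, ?_⟩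
    · rintro ⟨j, hj, hm, hFj⟩
      exact hcon j (by omega) (by omega) hFj
    · rcases he with ⟨hv, h0⟩ | ⟨u, huv, hu⟩
      · exact .inl ⟨hv, by omega⟩
      · exact .inr ⟨u, huv, hu.mono (by omega) (by omega)⟩
  have hinj : Function.Injective fun t : ℕ => (v, e + 2 * t + 1) := by
    intro t t' h
    simp only [Prod.mk.injEq, true_and] at h
    omega
  have hle := Set.ncard_le_ncard (s := (fun t : ℕ => (v, e + 2 * t + 1)) '' Set.Iic s.ncard)
    (t := s) (by rintro _ ⟨t, ht, rfl⟩; exact hblock t ht) hs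
  rw [Set.ncard_image_of_injective _ hinj] at hle
  have : (Set.Iic s.ncard).ncard = s.ncard + 1 := by
    rw [Set.ncard_eq_toFinset_card']
    simp
  omega

lemma exists_reachesIn (hF : IsFiring G A v₀ F) {i : ℕ} {v : V} (h : F i v) :
    ∃ k, k % 2 = i % 2 ∧ ReachesIn G v₀ k v := by
  induction i using Nat.strong_induction_on generalizing v with
  | _ i ih =>
    rcases ((hF i v).1 h).2.2 with ⟨rfl, h0⟩ | ⟨u, huv, j, hj, hm, hu⟩
    · exact ⟨0, by omega, reachesIn_zero⟩
    · obtain ⟨k, hk, hr⟩ := ih j (by omega) hu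
      exact ⟨k + 1, by omega, hr.succ huv.symm⟩

/-- The blocked pairs of nodes and rounds that can affect nodes reached within `k` steps. -/
def blockedUpTo (G : SimpleGraph V) (A : V → ℕ → Bool) (v₀ : V) (k : ℕ) : Set (V × ℕ) :=
  {p | p ∈ blockedPairs A ∧ ∃ m ≤ k, (m + 1) % 2 = p.2 % 2 ∧ ReachesIn G v₀ m p.1}

lemma blockedUpTo_mono {k l : ℕ} (h : k ≤ l) :
    blockedUpTo G A v₀ k ⊆ blockedUpTo G A v₀ l :=
  fun _ ⟨hp, m, hm, hr⟩ => ⟨hp, m, hm.trans h, hr⟩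

lemma blockedUpTo_subset (k : ℕ) : blockedUpTo G A v₀ k ⊆ blockedPairs A := fun _ hp => hp.1

/-- Induction on layers of the double cover: blocks at a vertex first reached in layer `k + 1` are
outside `blockedUpTo G A v₀ k`, so no block is charged twice along a walk. -/
lemma exists_fires_le_blockedUpTo (hF : IsFiring G A v₀ F) (hA : IsAvailabilityScheme A) {k : ℕ}
    {v : V} (h : ReachesIn G v₀ k v) :
    ∃ j ≤ k + 2 * (blockedUpTo G A v₀ k).ncard, j % 2 = k % 2 ∧ F j v := by
  have hfin : ∀ l, (blockedUpTo G A v₀ l).Finite := fun l => hA.subset (blockedUpTo_subset l)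
  induction k using Nat.strong_induction_on generalizing v with
  | _ k ih =>
    -- A shorter walk of the same parity puts the vertex in an earlier layer, where the bound is
    -- only smaller.
    by_cases hmin : ∃ l < k, l % 2 = k % 2 ∧ ReachesIn G v₀ l v
    · obtain ⟨l, hl, hm, hr⟩ := hmin
      obtain ⟨j, hj, hjm, hFj⟩ := ih l hl hr
      have := Set.ncard_le_ncard (blockedUpTo_mono (G := G) (A := A) (v₀ := v₀) hl.le) (hfin k)
      exact ⟨j, by omega, by omega, hFj⟩
    · match k, h with
      | 0, h =>
        refine hF.exists_fires_le (.inl ⟨reachesIn_zero_iff.1 h, rfl⟩) (hfin 0) fun i hi hb => ?_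
        exact ⟨hb, 0, le_rfl, by simp only; omega, h⟩
      | k + 1, h =>
        obtain ⟨u, huv, hu⟩ := reachesIn_succ_iff.1 h
        obtain ⟨j, hj, hjm, hFj⟩ := ih k (by omega) hu
        have hcard := Set.ncard_sdiff_add_ncard_of_subset
          (blockedUpTo_mono (G := G) (A := A) (v₀ := v₀) (Nat.le_succ k)) (hfin (k + 1))
        obtain ⟨j', hj', hm', hFj'⟩ := hF.exists_fires_le (e := j + 1) (v := v)
          (.inr ⟨u, huv.symm, j, by omega, by omega, hFj⟩)
          ((hfin (k + 1)).subset (Set.sdiff_subset (t := blockedUpTo G A v₀ k))) fun i hi hb => by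
            refine ⟨⟨hb, k + 1, le_rfl, by simp only; omega, h⟩, ?_⟩
            rintro ⟨-, m, hm, hmm, hr⟩
            exact hmin ⟨m, by omega, by simp only at hmm; omega, hr⟩
        exact ⟨j', by simp only [Nat.succ_eq_add_one] at hcard; omega, by omega, hFj'⟩

/-- A node reached by a walk of length `k` fires at a time of the same parity, at most
`2 * f` later. -/
theorem exists_fires_le_ncard (hF : IsFiring G A v₀ F) (hA : IsAvailabilityScheme A) {k : ℕ}
    {v : V} (h : ReachesIn G v₀ k v) :
    ∃ j ≤ k + 2 * (blockedPairs A).ncard, j % 2 = k % 2 ∧ F j v := by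
  obtain ⟨j, hj, hm, hFj⟩ := hF.exists_fires_le_blockedUpTo hA h
  have := Set.ncard_le_ncard (blockedUpTo_subset (G := G) (A := A) (v₀ := v₀) k) hA
  exact ⟨j, by omega, hm, hFj⟩

/-- The first neighbor of `w` to fire at a time of a given parity does so before `w`. -/
lemma exists_first_fires (hF : IsFiring G A v₀ F) {w : V} (hw : w ≠ v₀) {j : ℕ} {u : V}
    (huw : G.Adj u w) (hu : F j u) :
    ∃ i ≤ j, ∃ v, F i v ∧ G.Adj v w ∧ ¬ HasFired F (i + 1) w := by
  induction j using Nat.strong_induction_on generalizing u with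
  | _ j ih =>
    by_cases h : HasFired F (j + 1) w
    · obtain ⟨k, hk, -, hFk⟩ := h
      rcases ((hF k w).1 hFk).2.2 with ⟨rfl, -⟩ | ⟨u', hu', l, hl, hlm, hFl⟩
      · exact absurd rfl hw
      · obtain ⟨i, hi, hv⟩ := ih l (by omega) hu'.symm hFl
        exact ⟨i, by omega, hv⟩
    · exact ⟨j, le_rfl, u, hu, huw, h⟩

/-- Of the two ends of an edge of the double cover, one fires before the other. -/
lemma exists_forward (hF : IsFiring G A v₀ F) (hA : IsAvailabilityScheme A) {a b : V} {k : ℕ}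
    (hab : G.Adj a b) (h : ReachesIn G v₀ k a) :
    ∃ i, (i % 2 = k % 2 ∧ F i a ∧ ¬ HasFired F (i + 1) b) ∨
      (i % 2 = (k + 1) % 2 ∧ F i b ∧ ¬ HasFired F (i + 1) a) := by
  obtain ⟨i, -, him, hi⟩ := hF.exists_fires_le_ncard hA h
  obtain ⟨j, -, hjm, hj⟩ := hF.exists_fires_le_ncard hA (h.succ hab)
  rcases Nat.lt_or_ge i j with hij | hij
  · refine ⟨i, .inl ⟨him, hi, ?_⟩⟩
    rintro ⟨l, hl, hlm, hFl⟩
    have := hF.eq_of_fires hFl hj (by omega)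
    omega
  · refine ⟨j, .inr ⟨hjm, hj, ?_⟩⟩
    rintro ⟨l, hl, hlm, hFl⟩
    have := hF.eq_of_fires hFl hi (by omega)
    omega

/-- The message does not cross an edge of the double cover in both directions. -/
lemma not_forward_back {i j : ℕ} {v u : V} (hi : F i v) (hiu : ¬ HasFired F (i + 1) u)
    (hj : F j u) (hjv : ¬ HasFired F (j + 1) v) (hij : (i + j) % 2 = 1) : False := by
  have h1 : i + 1 ≤ j := by
    by_contra h
    exact hiu ⟨j, by omega, by omega, hj⟩
  exact hjv ⟨i, by omega, by omega, hi⟩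

end IsFiring

/-! ### The three assertions -/

section Main

variable {G : SimpleGraph V} {A : V → ℕ → Bool} {v₀ : V} {parity₀ : V → Bool}

theorem deliversWithin [Finite V] (hG : G.Connected) (hA : IsAvailabilityScheme A) :
    DeliversWithin G A v₀ parity₀ (G.diam + 2 * (blockedPairs A).ncard) := by
  intro w hw
  have hF := isFiring_fires G A v₀ parity₀
  have hpos : 0 < G.dist v₀ w := hG.pos_dist_of_ne hw.symm
  have hd := dist_le_diam_of_connected hG v₀ w
  have hr := reachesIn_dist hG v₀ w
  rw [show G.dist v₀ w = G.dist v₀ w - 1 + 1 by omega, reachesIn_succ_iff] at hr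
  obtain ⟨u, huw, hu⟩ := hr
  obtain ⟨j, hj, -, hFj⟩ := hF.exists_fires_le_ncard hA hu
  obtain ⟨i, hi, v, hv⟩ := hF.exists_first_fires hw huw hFj
  exact ⟨i + 1, by omega, v, (sends_succ_iff_fires i v w).2 hv⟩

/-- One end of the crossed edge of the cover fires by time `2 * diam + 2 * f`. A later crossing
would make the sender fire twice or target a vertex that has fired. -/
theorem terminatesWithin [Finite V] (hG : G.Connected) (hA : IsAvailabilityScheme A) :
    TerminatesWithin G A v₀ parity₀ (2 * G.diam + 2 * (blockedPairs A).ncard + 1) := by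
  intro i hi v u hs
  have hF := isFiring_fires G A v₀ parity₀
  obtain ⟨i, rfl⟩ : ∃ n, i = n + 1 := ⟨i - 1, by omega⟩
  obtain ⟨hv, -, hu⟩ := (sends_succ_iff_fires i v u).1 hs
  obtain ⟨k, hk, hr⟩ := hF.exists_reachesIn hv
  rcases exists_short_reachesIn hG u hr with ⟨l, hl, hlm, hlr⟩ | ⟨l, hl, hlm, hlr⟩
  · obtain ⟨j, hj, hjm, hFj⟩ := hF.exists_fires_le_ncard hA hlr
    have := hF.eq_of_fires hFj hv (by omega)
    omega
  · obtain ⟨j, hj, hjm, hFj⟩ := hF.exists_fires_le_ncard hA hlr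
    exact hu ⟨j, by omega, by omega, hFj⟩

lemma mem_forwards_iff {e : ℕ × V × V} :
    e ∈ forwards G A v₀ parity₀ ↔ ∃ i, e.1 = i + 1 ∧ Fires G A v₀ parity₀ i e.2.1 ∧
      G.Adj e.2.1 e.2.2 ∧ ¬ HasFired (Fires G A v₀ parity₀) (i + 1) e.2.2 := by
  obtain ⟨n, v, u⟩ := e
  cases n with
  | zero => simp [forwards, not_sends_zero]
  | succ i => simp [forwards, sends_succ_iff_fires]

theorem encard_forwards_of_isBipartite (hG : G.Connected) (hA : IsAvailabilityScheme A)
    (hb : G.IsBipartite) : (forwards G A v₀ parity₀).encard = G.edgeSet.encard := by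
  have hF := isFiring_fires G A v₀ parity₀
  obtain ⟨col⟩ := hb
  have hwalk : ∀ k v, ReachesIn G v₀ k v → ((col v : ℕ) + k) % 2 = col v₀ % 2 := by
    intro k
    induction k with
    | zero => intro v h; simp [reachesIn_zero_iff.1 h]
    | succ k ih =>
      intro v h
      obtain ⟨u, huv, hu⟩ := reachesIn_succ_iff.1 h
      have h1 := ih u hu
      have h2 : (col u : ℕ) ≠ col v := fun h => col.valid huv (Fin.ext h)
      have := (col u).isLt
      have := (col v).isLt
      omega
  -- The color of a node fixes the parity of its firing times, so only one of the two lifts of each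
  -- edge is used.
  have hcol : ∀ i v, Fires G A v₀ parity₀ i v → ((col v : ℕ) + i) % 2 = col v₀ % 2 := by
    intro i v h
    obtain ⟨k, hk, hr⟩ := hF.exists_reachesIn h
    have := hwalk k v hr
    omega
  have himg : (fun e : ℕ × V × V => s(e.2.1, e.2.2)) '' forwards G A v₀ parity₀ = G.edgeSet := by
    ext e
    induction e using Sym2.ind with
    | _ a b =>
      rw [SimpleGraph.mem_edgeSet]
      constructor
      · rintro ⟨⟨n, v, u⟩, he, heq⟩
        obtain ⟨i, -, -, hvu, -⟩ := mem_forwards_iff.1 he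
        rw [← SimpleGraph.mem_edgeSet, ← heq]
        exact hvu
      · intro hab
        obtain ⟨i, ⟨-, h1, h2⟩ | ⟨-, h1, h2⟩⟩ :=
          hF.exists_forward hA hab (reachesIn_dist hG v₀ a)
        · exact ⟨(i + 1, a, b), mem_forwards_iff.2 ⟨i, rfl, h1, hab, h2⟩, rfl⟩
        · exact ⟨(i + 1, b, a), mem_forwards_iff.2 ⟨i, rfl, h1, hab.symm, h2⟩, Sym2.eq_swap⟩
  rw [← himg, Set.InjOn.encard_image]
  rintro ⟨n, v, u⟩ he ⟨n', v', u'⟩ he' heq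
  obtain ⟨i, hi, hv, hvu, hu⟩ := mem_forwards_iff.1 he
  obtain ⟨i', hi', hv', hvu', hu'⟩ := mem_forwards_iff.1 he'
  simp only at hi hi' hv hv' hvu hvu' hu hu' heq
  subst hi hi'
  rcases Sym2.eq_iff.1 heq with ⟨rfl, rfl⟩ | ⟨rfl, rfl⟩
  · have h1 := hcol i v hv
    have h2 := hcol i' v hv'
    rw [hF.eq_of_fires hv hv' (by omega)]
  · have h1 := hcol i v hv
    have h2 := hcol i' u hv'
    have h3 : (col v : ℕ) ≠ col u := fun h => col.valid hvu (Fin.ext h)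
    have := (col u).isLt
    have := (col v).isLt
    exact (IsFiring.not_forward_back hv hu hv' hu' (by omega)).elim

lemma encard_setOf_adj [Finite V] (G : SimpleGraph V) :
    {p : V × V | G.Adj p.1 p.2}.encard = 2 * G.edgeSet.encard := by
  classical
  have := Fintype.ofFinite V
  have h1 : {p : V × V | G.Adj p.1 p.2} = Set.range (SimpleGraph.Dart.toProd (G := G)) := by
    ext p
    exact ⟨fun h => ⟨⟨p, h⟩, rfl⟩, by rintro ⟨d, rfl⟩; exact d.adj⟩
  rw [h1, ← Set.image_univ, (SimpleGraph.Dart.toProd_injective).encard_image,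
    Set.encard_univ, ENat.card_eq_coe_fintype_card, G.dart_card_eq_twice_card_edges,
    ← SimpleGraph.coe_edgeFinset, Set.encard_coe_eq_coe_finsetCard]
  push_cast
  rfl

theorem encard_forwards_of_not_isBipartite [Finite V] (hG : G.Connected)
    (hA : IsAvailabilityScheme A) (hb : ¬ G.IsBipartite) :
    (forwards G A v₀ parity₀).encard = 2 * G.edgeSet.encard := by
  have hF := isFiring_fires G A v₀ parity₀
  -- Orients each edge of the cover from its even-time end to its odd-time end; odd rounds are even
  -- times.
  let φ : ℕ × V × V → V × V := fun e => if e.1 % 2 = 1 then e.2 else e.2.swap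
  have himg : φ '' forwards G A v₀ parity₀ = {p : V × V | G.Adj p.1 p.2} := by
    ext ⟨a, b⟩
    constructor
    · rintro ⟨⟨n, v, u⟩, he, heq⟩
      obtain ⟨i, -, -, hvu, -⟩ := mem_forwards_iff.1 he
      rw [← heq]
      simp only [φ]
      split_ifs
      · exact hvu
      · exact hvu.symm
    · intro hab
      obtain ⟨k, hk, hr⟩ := exists_reachesIn_of_not_isBipartite (v₀ := v₀) hG hb 0 a
      obtain ⟨i, ⟨hm, h1, h2⟩ | ⟨hm, h1, h2⟩⟩ := hF.exists_forward hA hab hr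
      · refine ⟨(i + 1, a, b), mem_forwards_iff.2 ⟨i, rfl, h1, hab, h2⟩, ?_⟩
        exact if_pos (by simp only; omega)
      · refine ⟨(i + 1, b, a), mem_forwards_iff.2 ⟨i, rfl, h1, hab.symm, h2⟩, ?_⟩
        exact if_neg (by simp only; omega)
  rw [← encard_setOf_adj, ← himg, Set.InjOn.encard_image]
  rintro ⟨n, v, u⟩ he ⟨n', v', u'⟩ he' heq
  obtain ⟨i, hi, hv, hvu, hu⟩ := mem_forwards_iff.1 he
  obtain ⟨i', hi', hv', hvu', hu'⟩ := mem_forwards_iff.1 he'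
  simp only at hi hi' hv hv' hvu hvu' hu hu'
  subst hi hi'
  simp only [φ] at heq
  split_ifs at heq with c c' c' <;>
    simp only [Prod.swap_prod_mk, Prod.mk.injEq] at heq <;> obtain ⟨rfl, rfl⟩ := heq
  · rw [hF.eq_of_fires hv hv' (by omega)]
  · exact (IsFiring.not_forward_back hv hu hv' hu' (by omega)).elim
  · exact (IsFiring.not_forward_back hv hu hv' hu' (by omega)).elim
  · rw [hF.eq_of_fires hv hv' (by omega)]

end Main

end AmnesiacFlooding

theorem mainTheorem1 {V : Type*} [Finite V] (G : SimpleGraph V) (hG : G.Connected)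
    (A : V → ℕ → Bool) (hA : AmnesiacFlooding.IsAvailabilityScheme A)
    (f : ℕ) (hf : f = (AmnesiacFlooding.blockedPairs A).ncard)
    (v₀ : V) (parity₀ : V → Bool) :
    AmnesiacFlooding.DeliversWithin G A v₀ parity₀ (G.diam + 2 * f) ∧
    AmnesiacFlooding.TerminatesWithin G A v₀ parity₀ (2 * G.diam + 2 * f + 1) ∧
    (G.IsBipartite →
      (AmnesiacFlooding.forwards G A v₀ parity₀).encard = G.edgeSet.encard) ∧
    (¬ G.IsBipartite →
      (AmnesiacFlooding.forwards G A v₀ parity₀).encard = 2 * G.edgeSet.encard) := by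
  subst hf
  exact ⟨AmnesiacFlooding.deliversWithin hG hA, AmnesiacFlooding.terminatesWithin hG hA,
    AmnesiacFlooding.encard_forwards_of_isBipartite hG hA,
    AmnesiacFlooding.encard_forwards_of_not_isBipartite hG hA⟩
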